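/- **Theorem 1.** Let $M,N_a,\tau_c,T\ge 1$ and $K\ge 0$ be integers, let $L$ be a real number, and let $0<\epsilon\le 1$ and $\delta>0$. There are $M$ access points (APs). The data of AP $m$ are a set $\Omega_m\subseteq\{1,\dots,N_a\}\times\{1,\dots,\tau_c\}$ of observed positions and a matrix $\mathbf Y_m\in\mathbb C^{N_a\times\tau_c}$; they are *possible* if $\mathbf Y_m$ vanishes outside $\Omega_m$ and $\|\mathbf Y_m\|_{\mathcal F}\le L$. For a matrix $\mathbf A$, $(\mathbf A)_{\Omega}$ denotes $\mathbf A$ with the entries outside $\Omega$ set to zero, and $\Xi_{L,\Omega}(\mathbf A)=\min\{L/\|(\mathbf A)_\Omega\|_{\mathcal F},1\}\,\mathbf A$ (the minimum being $1$ if $(\mathbf A)_\Omega=0$). Put $$\mu=\frac{16L^2}{\epsilon}\sqrt{\frac TM\ln\Big(\frac{2.5\,T}{\delta}\Big)\ln\Big(\frac2\delta\Big)}$$ (the square root being read as $0$ if its argument is negative, which can occur only for $\delta>2$). Consider the following randomized algorithm (Frank–Wolfe-based privacy-preserving matrix completion). Set $\mathbf X_m^{(0)}=\mathbf 0$ for all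 $m$, $\eta^{(1)}=1$ and $\eta^{(n)}=1/T$ for $2\le n\le T$. For $n=1,\dots,T$: 1. Each AP $m$ computes $\mathbf J_m^{(n-1)}=(\mathbf X_m^{(n-1)})_{\Omega_m}-\mathbf Y_m$ and sends $(\mathbf J_m^{(n-1)})^{\rm H}\mathbf J_m^{(n-1)}+\mathbf G_m^{(n-1)}$ to the central processing unit (CPU). Here $\mathbf G_m^{(n-1)}$ is a Hermitian $\tau_c\times\tau_c$ noise matrix whose entries on and above the diagonal are independent, $\mathcal N(0,\mu^2)$ on the diagonal and circularly symmetric complex Gaussian $\mathcal N_c(0,\mu^2)$ above it (real and imaginary parts independent $\mathcal N(0,\mu^2/2)$); the noise matrices are independent over all APs and iterations. 2. The CPU forms the sum $\widehat{\mathbb W}^{(n-1)}$ of the received matrices and computes a unit eigenvector $\widehat{\mathbf v}^{(n)}$ for its largest eigenvalue and the square root $\widehat\lambda^{(n)}$ of this eigenvalue, by some fixed measurable rule. (The choice of the eigenvector, and of a real value of $\widehat\lambda^{(n)}$ when the largest eigenvalue is negative, is left to the rule.) It broadcasts $\widehat{\mathbf v}^{(n)}$ and $\widetilde\lambda^{(n)}=\widehat\lambda^{(n)}+\sqrt\mu\,(M\tau_c)^{1/4}$.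 3. Each AP $m$ sets (with the quotient read as $0$ if $\widetilde\lambda^{(n)}=0$) $$\mathbf X_m^{(n)}=\Xi_{L,\Omega_m}\Big((1-\eta^{(n)})\mathbf X_m^{(n-1)}-\frac{\eta^{(n)}K}{\widetilde\lambda^{(n)}}\,\mathbf J_m^{(n-1)}\widehat{\mathbf v}^{(n)}(\widehat{\mathbf v}^{(n)})^{\rm H}\Big).$$ The output is $\widehat{\mathbf X}_m=\mathbf X_m^{(T)}$ for each AP $m$. For every such rule of the CPU, this algorithm is $(\epsilon,\delta)$-joint differentially private: for every AP $m$, any two families of possible data $\mathbf Y,\mathbf Y'$ of the $M$ APs that agree at all APs other than $m$, and every measurable set $S\subseteq(\mathbb C^{N_a\times\tau_c})^{M-1}$, $$P\big[(\widehat{\mathbf X}_j(\mathbf Y))_{j\ne m}\in S\big]\le e^{\epsilon}\,P\big[(\widehat{\mathbf X}_j(\mathbf Y'))_{j\ne m}\in S\big]+\delta ,$$ where the probability is over the noise matrices. -/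

import Mathlib

open MeasureTheory ProbabilityTheory
open scoped Matrix

namespace PrivateFW

noncomputable section

/-- The Borel (entrywise product) σ-algebra on complex matrices. -/
instance instMeasurableSpaceMatrix {a b : ℕ} : MeasurableSpace (Matrix (Fin a) (Fin b) ℂ) :=
  inferInstanceAs (MeasurableSpace (Fin a → Fin b → ℂ))

/-- The Frobenius norm of a complex matrix. -/
def frobNorm {a b : ℕ} (A : Matrix (Fin a) (Fin b) ℂ) : ℝ :=
  Real.sqrt (∑ i, ∑ j, ‖A i j‖ ^ 2)

/-- `(A)_Ω`: the entries of `A` outside the index set `Ω` are replaced by zero. -/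
def restrictTo {a b : ℕ} (Ω : Finset (Fin a × Fin b)) (A : Matrix (Fin a) (Fin b) ℂ) :
    Matrix (Fin a) (Fin b) ℂ :=
  Matrix.of fun i j => if (i, j) ∈ Ω then A i j else 0

/-- The data of one access point: the set `Ω_m` of observed (antenna, time slot) pairs and the
sampled received signal `Y_m`. -/
structure LocalData (Na τ : ℕ) where
  mask : Finset (Fin Na × Fin τ)
  signal : Matrix (Fin Na) (Fin τ) ℂ

/-- The possible values of the data of an access point: `Y_m` vanishes outside `Ω_m` and
`‖Y_m‖_F ≤ L`. -/
def LocalData.IsPossible {Na τ : ℕ} (L : ℝ) (d : LocalData Na τ) : Prop :=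
  (∀ i t, (i, t) ∉ d.mask → d.signal i t = 0) ∧ frobNorm d.signal ≤ L

/-- `(ε, δ)`-joint differential privacy of a randomized algorithm `A` that receives one datum in
`D` from each of `M` parties and returns one output in `Q` to each of them; `P` is the law of the
internal randomness `ω : R`, and `possible` is the set of possible values of a party's datum. -/
def IsJointDP {M : ℕ} {D Q R : Type*} [MeasurableSpace Q] [MeasurableSpace R]
    (P : Measure R) (A : (Fin M → D) → R → Fin M → Q) (possible : D → Prop) (ε δ : ℝ) : Prop :=
  ∀ (m : Fin M) (Y Y' : Fin M → D), (∀ j, possible (Y j)) → (∀ j, possible (Y' j)) →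
    (∀ j, j ≠ m → Y j = Y' j) →
    ∀ S : Set ({j : Fin M // j ≠ m} → Q), MeasurableSet S →
      P {ω | (fun j : {j : Fin M // j ≠ m} => A Y ω j) ∈ S} ≤
        ENNReal.ofReal (Real.exp ε) * P {ω | (fun j : {j : Fin M // j ≠ m} => A Y' ω j) ∈ S}
          + ENNReal.ofReal δ

/-- The calibrated noise level `μ` (a standard deviation). -/
def noiseLevel (M T : ℕ) (L ε δ : ℝ) : ℝ :=
  16 * L ^ 2 * Real.sqrt ((T : ℝ) / M * Real.log (2.5 * T / δ) * Real.log (2 / δ)) / ε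

/-- The Hermitian matrix with diagonal entries `g i i`, entries `g i j + √-1 g j i` above the
diagonal, and their complex conjugates below the diagonal. -/
def hermitianOf {τ : ℕ} (g : Fin τ → Fin τ → ℝ) : Matrix (Fin τ) (Fin τ) ℂ :=
  Matrix.of fun i j =>
    if i = j then (g i i : ℂ)
    else if i < j then (g i j : ℂ) + (g j i : ℂ) * Complex.I
    else (g j i : ℂ) - (g i j : ℂ) * Complex.I

/-- The law of a Hermitian noise matrix with independent entries on and above the diagonal:
`N(0, μ²)` on the diagonal, and circularly symmetric complex `N_c(0, μ²)` above it (real and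
imaginary parts independent, each `N(0, μ²/2)`). -/
def hermitianNoise (τ : ℕ) (μ : ℝ) : Measure (Matrix (Fin τ) (Fin τ) ℂ) :=
  (Measure.pi fun i : Fin τ => Measure.pi fun j : Fin τ =>
    gaussianReal 0 (if i = j then (μ ^ 2).toNNReal else (μ ^ 2 / 2).toNNReal)).map hermitianOf

/-- The law of all noise matrices: independent over the `T` iterations and the `M` access
points. -/
def noiseLaw (T M τ : ℕ) (μ : ℝ) : Measure (Fin T → Fin M → Matrix (Fin τ) (Fin τ) ℂ) :=
  Measure.pi fun _ : Fin T => Measure.pi fun _ : Fin M => hermitianNoise τ μ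

/-- `lam` is the largest eigenvalue of `W`, and `v` is a unit eigenvector for it. -/
def IsLargestEigenpair {τ : ℕ} (W : Matrix (Fin τ) (Fin τ) ℂ) (lam : ℝ) (v : Fin τ → ℂ) : Prop :=
  star v ⬝ᵥ v = 1 ∧ W *ᵥ v = (lam : ℂ) • v ∧
    ∀ (x : ℝ) (u : Fin τ → ℂ), u ≠ 0 → W *ᵥ u = (x : ℂ) • u → x ≤ lam

/-- A rule by which the CPU computes `(lamHat, v)` from a Hermitian matrix `W`: `v` is a unit
eigenvector for the largest eigenvalue of `W`, and `lamHat` is the square root of that eigenvalue.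
Which eigenvector is taken, and which real number serves as `lamHat` when the largest eigenvalue
is negative, is left to the rule. -/
def IsTopEigenRule {τ : ℕ} (cpu : Matrix (Fin τ) (Fin τ) ℂ → ℝ × (Fin τ → ℂ)) : Prop :=
  ∀ W : Matrix (Fin τ) (Fin τ) ℂ, W.IsHermitian →
    ∃ lam : ℝ, IsLargestEigenpair W lam (cpu W).2 ∧ (0 ≤ lam → (cpu W).1 = Real.sqrt lam)

/-- `Ξ_{L,Ω}(A) = min {L / ‖(A)_Ω‖_F, 1} A`, where the minimum is `1` if `(A)_Ω = 0`. -/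
def clip {a b : ℕ} (L : ℝ) (Ω : Finset (Fin a × Fin b)) (A : Matrix (Fin a) (Fin b) ℂ) :
    Matrix (Fin a) (Fin b) ℂ :=
  if frobNorm (restrictTo Ω A) ≤ L then A
  else ((L / frobNorm (restrictTo Ω A) : ℝ) : ℂ) • A

/-- The residual `J_m = (X_m)_{Ω_m} - Y_m`. -/
def residual {Na τ : ℕ} (d : LocalData Na τ) (X : Matrix (Fin Na) (Fin τ) ℂ) :
    Matrix (Fin Na) (Fin τ) ℂ :=
  restrictTo d.mask X - d.signal

/-- What access point `m` sends to the CPU: `J_mᴴ J_m + G_m`. -/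
def noisyGram {Na τ : ℕ} (d : LocalData Na τ) (X : Matrix (Fin Na) (Fin τ) ℂ)
    (G : Matrix (Fin τ) (Fin τ) ℂ) : Matrix (Fin τ) (Fin τ) ℂ :=
  (residual d X)ᴴ * residual d X + G

/-- The update of an access point, from its data, its iterate `X`, the step size `η` and the
broadcast pair `(lamTilde, v)`. -/
def localUpdate {Na τ : ℕ} (K : ℕ) (L η : ℝ) (d : LocalData Na τ)
    (X : Matrix (Fin Na) (Fin τ) ℂ) (lamTilde : ℝ) (v : Fin τ → ℂ) :
    Matrix (Fin Na) (Fin τ) ℂ :=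
  clip L d.mask
    (((1 - η : ℝ) : ℂ) • X
      - ((η * K / lamTilde : ℝ) : ℂ) • (residual d X * Matrix.vecMulVec v (star v)))

/-- The step sizes `η⁽¹⁾ = 1` and `η⁽ⁿ⁾ = 1 / T` for `n ≥ 2`. -/
def stepSize (T n : ℕ) : ℝ := if n = 1 then 1 else 1 / T

/-- One iteration with step size `η` and noise matrices `G m`, for all access points: the CPU
computes `(lamHat, v)` from the sum of the received matrices and broadcasts
`lamTilde = lamHat + √μ (M τ)^{1/4}` and `v`. -/
def fwStep {M Na τ : ℕ} (K : ℕ) (L μ η : ℝ)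
    (cpu : Matrix (Fin τ) (Fin τ) ℂ → ℝ × (Fin τ → ℂ)) (Y : Fin M → LocalData Na τ)
    (G : Fin M → Matrix (Fin τ) (Fin τ) ℂ) (X : Fin M → Matrix (Fin Na) (Fin τ) ℂ) :
    Fin M → Matrix (Fin Na) (Fin τ) ℂ :=
  let W := ∑ m, noisyGram (Y m) (X m) (G m)
  let lamTilde := (cpu W).1 + Real.sqrt μ * ((M : ℝ) * τ) ^ (1 / 4 : ℝ)
  fun m => localUpdate K L η (Y m) (X m) lamTilde (cpu W).2

/-- The iterates `X⁽ⁿ⁾`, starting from `X⁽⁰⁾ = 0`; iteration `n + 1` uses the noise `G n`. -/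
def fwIterate {M Na τ T : ℕ} (K : ℕ) (L μ : ℝ)
    (cpu : Matrix (Fin τ) (Fin τ) ℂ → ℝ × (Fin τ → ℂ)) (Y : Fin M → LocalData Na τ)
    (G : Fin T → Fin M → Matrix (Fin τ) (Fin τ) ℂ) :
    (n : ℕ) → n ≤ T → Fin M → Matrix (Fin Na) (Fin τ) ℂ
  | 0, _ => 0
  | n + 1, h =>
      fwStep K L μ (stepSize T (n + 1)) cpu Y (G ⟨n, h⟩)
        (fwIterate K L μ cpu Y G n (Nat.le_of_succ_le h))

/-- The output `X⁽ᵀ⁾` of the Frank-Wolfe-based algorithm run with noise matrices `G`. -/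
def privateFW {M Na τ T : ℕ} (K : ℕ) (L μ : ℝ)
    (cpu : Matrix (Fin τ) (Fin τ) ℂ → ℝ × (Fin τ → ℂ)) (Y : Fin M → LocalData Na τ)
    (G : Fin T → Fin M → Matrix (Fin τ) (Fin τ) ℂ) : Fin M → Matrix (Fin Na) (Fin τ) ℂ :=
  fwIterate K L μ cpu Y G T le_rfl

end

end PrivateFW

/-! Run the algorithm on two data families that differ at the access point `m` only. If in an
iteration every access point adds to its noise matrix `1 / M` of the change of the Gram matrix of
`m`, the CPU sees the same sum in both runs and broadcasts the same pair, so the iterates of all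
other access points stay equal. The clipping keeps the residuals below `2 L`, so the change is at
most `8 L²` in Frobenius norm, and the Rényi divergence of order `p` caused by shifting the Gaussian
noise is bounded accordingly, using that a Hermitian noise matrix is isotropic for this norm. These
costs add up over access points and iterations, although each shift depends on the past: in place of
a joint law of the two runs one carries along a Hölder inequality for pairs of test functions.
Young's inequality then turns a bound on the Rényi divergence of order `p` into an `(ε, δ)`-bound,
and the noise level is such that `p = 1 + 4 log (2.5 T / δ) log (2 / δ) / ε` is a suitable order. -/

open scoped ENNReal NNReal

theorem exp_mul_rpow_inv_le {p q : ℝ} (hpq : p.HolderConjugate q) (c ε : ℝ) {x : ℝ} (hx : 0 ≤ x) :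
    Real.exp c * x ^ q⁻¹ ≤ Real.exp ε * x + Real.exp (p * c - (p - 1) * ε) := by
  have hsplit : Real.exp c * x ^ q⁻¹ =
      Real.exp (c - ε / q) * (Real.exp (ε / q) * x ^ q⁻¹) := by
    rw [← mul_assoc, ← Real.exp_add, sub_add_cancel]
  have hp : Real.exp (c - ε / q) ^ p = Real.exp (p * c - (p - 1) * ε) := by
    rw [← Real.exp_mul, ← hpq.div_conj_eq_sub_one]
    ring_nf
  have hq : (Real.exp (ε / q) * x ^ q⁻¹) ^ q = Real.exp ε * x := by
    rw [Real.mul_rpow (Real.exp_pos _).le (by positivity), ← Real.exp_mul,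
      Real.rpow_inv_rpow hx hpq.symm.ne_zero, div_mul_cancel₀ _ hpq.symm.ne_zero]
  calc Real.exp c * x ^ q⁻¹ = Real.exp (c - ε / q) * (Real.exp (ε / q) * x ^ q⁻¹) := hsplit
    _ ≤ Real.exp (p * c - (p - 1) * ε) / p + Real.exp ε * x / q := by
        rw [← hp, ← hq]
        exact Real.young_inequality_of_nonneg (by positivity) (by positivity) hpq
    _ ≤ Real.exp (p * c - (p - 1) * ε) + Real.exp ε * x :=
        add_le_add (div_le_self (by positivity) hpq.lt.le)
          (div_le_self (by positivity) hpq.symm.lt.le)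
    _ = _ := add_comm _ _

/-- `P` and `Q` are approximately coupled along the relation `R`, with exponent `q` and cost `c`.
If `R` is equality, this says by duality that `P` has a density with respect to `Q` of norm at most
`exp c` in `L^p(Q)`, `p` being conjugate to `q`, so it is a bound on a Rényi divergence. Testing on
functions, instead of asking for a joint law, lets costs add up when couplings are composed. -/
def HolderCoupled {X Y : Type*} [MeasurableSpace X] [MeasurableSpace Y] (R : X → Y → Prop)
    (q c : ℝ) (P : Measure X) (Q : Measure Y) : Prop :=
  ∀ ⦃f : X → ℝ≥0∞⦄ ⦃g : Y → ℝ≥0∞⦄, Measurable f → Measurable g → (∀ x y, R x y → f x ≤ g y) →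
    ∫⁻ x, f x ∂P ≤ ENNReal.ofReal (Real.exp c) * (∫⁻ y, g y ^ q ∂Q) ^ q⁻¹

namespace HolderCoupled

variable {X Y X' Y' : Type*} [MeasurableSpace X] [MeasurableSpace Y] [MeasurableSpace X']
  [MeasurableSpace Y'] {P : Measure X} {Q : Measure Y} {R : X → Y → Prop} {q c d : ℝ}

theorem mono {R' : X → Y → Prop} (h : HolderCoupled R q c P Q) (hR : ∀ x y, R x y → R' x y)
    (hcd : c ≤ d) : HolderCoupled R' q d P Q := by
  intro f g hf hg hfg
  refine (h hf hg fun x y hxy => hfg x y (hR x y hxy)).trans ?_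
  gcongr

theorem map {φ : X → X'} {ψ : Y → Y'} {R : X' → Y' → Prop}
    (h : HolderCoupled (fun x y => R (φ x) (ψ y)) q c P Q) (hφ : Measurable φ)
    (hψ : Measurable ψ) : HolderCoupled R q c (P.map φ) (Q.map ψ) := by
  intro f g hf hg hfg
  rw [lintegral_map hf hφ, lintegral_map (hg.pow_const q) hψ]
  exact h (hf.comp hφ) (hg.comp hψ) fun x y => hfg (φ x) (ψ y)

theorem dirac (hq : q ≠ 0) {x : X} {y : Y} (hxy : R x y) :
    HolderCoupled R q 0 (Measure.dirac x) (Measure.dirac y) := by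
  intro f g hf hg hfg
  simpa [lintegral_dirac' _ hf, lintegral_dirac' _ (hg.pow_const q), ENNReal.rpow_rpow_inv hq]
    using hfg x y hxy

theorem prod (hq : q ≠ 0) {P' : Measure X'} {Q' : Measure Y'} [SFinite P'] [SFinite Q']
    {S : X × X' → Y × Y' → Prop} (h : HolderCoupled R q c P Q)
    (h' : ∀ x y, R x y → HolderCoupled (fun x' y' => S (x, x') (y, y')) q d P' Q') :
    HolderCoupled S q (c + d) (P.prod P') (Q.prod Q') := by
  intro f g hf hg hfg
  -- The second couplings bound the fibre integrals of `f` by `exp d` times the fibre norms `N` of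
  -- `g`, so the first coupling applies to these.
  let N : Y → ℝ≥0∞ := fun y => (∫⁻ y', g (y, y') ^ q ∂Q') ^ q⁻¹
  have hN : Measurable N := (hg.pow_const q).lintegral_prod_right'.pow_const _
  have hf' : Measurable fun x => (ENNReal.ofReal (Real.exp d))⁻¹ * ∫⁻ x', f (x, x') ∂P' :=
    hf.lintegral_prod_right'.const_mul _
  have hd : ENNReal.ofReal (Real.exp d) ≠ 0 := by simp [Real.exp_pos]
  have hfN : ∀ x y, R x y →
      (ENNReal.ofReal (Real.exp d))⁻¹ * ∫⁻ x', f (x, x') ∂P' ≤ N y := fun x y hxy => by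
    rw [mul_comm, ← div_eq_mul_inv]
    refine ENNReal.div_le_of_le_mul' ?_
    exact h' x y hxy (hf.comp measurable_prodMk_left) (hg.comp measurable_prodMk_left)
      fun _ _ => hfg _ _
  calc ∫⁻ z, f z ∂(P.prod P') = ∫⁻ x, ∫⁻ x', f (x, x') ∂P' ∂P := lintegral_prod _ hf.aemeasurable
    _ = ENNReal.ofReal (Real.exp d) *
          ∫⁻ x, (ENNReal.ofReal (Real.exp d))⁻¹ * ∫⁻ x', f (x, x') ∂P' ∂P := by
        rw [lintegral_const_mul _ hf.lintegral_prod_right', ← mul_assoc,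
          ENNReal.mul_inv_cancel hd ENNReal.ofReal_ne_top, one_mul]
    _ ≤ ENNReal.ofReal (Real.exp d) *
          (ENNReal.ofReal (Real.exp c) * (∫⁻ y, N y ^ q ∂Q) ^ q⁻¹) := by
        gcongr
        exact h hf' hN hfN
    _ = ENNReal.ofReal (Real.exp (c + d)) * (∫⁻ z, g z ^ q ∂(Q.prod Q')) ^ q⁻¹ := by
        rw [lintegral_prod _ (hg.pow_const q).aemeasurable, add_comm, Real.exp_add,
          ENNReal.ofReal_mul (Real.exp_pos _).le, mul_assoc]
        simp only [N, ENNReal.rpow_inv_rpow hq]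

section Pi

variable {n : ℕ} {Z W : Fin (n + 1) → Type*} [∀ i, MeasurableSpace (Z i)]
  [∀ i, MeasurableSpace (W i)]

theorem pi_cons (hq : q ≠ 0) {P : ∀ i, Measure (Z i)} {Q : ∀ i, Measure (W i)}
    [∀ i, SigmaFinite (P i)] [∀ i, SigmaFinite (Q i)] {R : Z 0 → W 0 → Prop}
    {S : (∀ i, Z i) → (∀ i, W i) → Prop} (h : HolderCoupled R q c (P 0) (Q 0))
    (h' : ∀ x y, R x y → HolderCoupled (fun x' y' => S (Fin.cons x x') (Fin.cons y y')) q d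
      (Measure.pi fun i => P (Fin.succ i)) (Measure.pi fun i => Q (Fin.succ i))) :
    HolderCoupled S q (c + d) (Measure.pi P) (Measure.pi Q) := by
  have hP := (measurePreserving_piFinSuccAbove P 0).symm
  have hQ := (measurePreserving_piFinSuccAbove Q 0).symm
  rw [← hP.map_eq, ← hQ.map_eq]
  refine map (prod hq h fun x y hxy => ?_) hP.measurable hQ.measurable
  refine (h' x y hxy).mono (fun x' y' hS => ?_) le_rfl
  convert hS
  · exact Fin.insertNth_zero x x'
  · exact Fin.insertNth_zero y y'

end Pi

theorem pi_fin (hq : q ≠ 0) {n : ℕ} {Z W : Fin n → Type*} [∀ i, MeasurableSpace (Z i)]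
    [∀ i, MeasurableSpace (W i)] {P : ∀ i, Measure (Z i)} {Q : ∀ i, Measure (W i)}
    [∀ i, SigmaFinite (P i)] [∀ i, SigmaFinite (Q i)] {R : ∀ i, Z i → W i → Prop} {c : Fin n → ℝ}
    (h : ∀ i, HolderCoupled (R i) q (c i) (P i) (Q i)) :
    HolderCoupled (fun x y => ∀ i, R i (x i) (y i)) q (∑ i, c i) (Measure.pi P) (Measure.pi Q) := by
  induction n with
  | zero =>
    rw [Measure.pi_of_empty, Measure.pi_of_empty, Fin.sum_univ_zero]
    exact dirac hq fun i => i.elim0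
  | succ n ih =>
    rw [Fin.sum_univ_succ]
    refine pi_cons hq (h 0) fun x y hxy => (ih fun i => h i.succ).mono (fun x' y' h' => ?_) le_rfl
    exact Fin.cases hxy h'

theorem pi (hq : q ≠ 0) {ι : Type*} [Fintype ι] {Z W : ι → Type*} [∀ i, MeasurableSpace (Z i)]
    [∀ i, MeasurableSpace (W i)] {P : ∀ i, Measure (Z i)} {Q : ∀ i, Measure (W i)}
    [∀ i, SigmaFinite (P i)] [∀ i, SigmaFinite (Q i)] {R : ∀ i, Z i → W i → Prop} {c : ι → ℝ}
    (h : ∀ i, HolderCoupled (R i) q (c i) (P i) (Q i)) :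
    HolderCoupled (fun x y => ∀ i, R i (x i) (y i)) q (∑ i, c i) (Measure.pi P) (Measure.pi Q) := by
  let e := (Fintype.equivFin ι).symm
  have hP := measurePreserving_piCongrLeft P e
  have hQ := measurePreserving_piCongrLeft Q e
  rw [← hP.map_eq, ← hQ.map_eq, ← e.sum_comp]
  refine map ((pi_fin hq fun i => h (e i)).mono (fun x y hxy i => ?_) le_rfl)
    hP.measurable hQ.measurable
  obtain ⟨i, rfl⟩ := e.surjective i
  simpa only [MeasurableEquiv.coe_piCongrLeft, Equiv.piCongrLeft_apply_apply] using hxy i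

theorem foldl (hq : q ≠ 0) {A B : Type*} {n : ℕ} [SigmaFinite P] [SigmaFinite Q]
    {R : A → B → Prop} {f : Fin n → X → A → A} {g : Fin n → Y → B → B}
    (h : ∀ i a b, R a b → HolderCoupled (fun x y => R (f i x a) (g i y b)) q c P Q)
    {a : A} {b : B} (hab : R a b) :
    HolderCoupled (fun x y => R (Fin.foldl n (fun a i => f i (x i) a) a)
      (Fin.foldl n (fun b i => g i (y i) b) b)) q (n * c)
      (Measure.pi fun _ : Fin n => P) (Measure.pi fun _ : Fin n => Q) := by
  induction n generalizing a b with
  | zero =>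
    rw [Measure.pi_of_empty, Measure.pi_of_empty, Nat.cast_zero, zero_mul]
    exact dirac hq (by simpa only [Fin.foldl_zero] using hab)
  | succ n ih =>
    have hcost : ((n + 1 : ℕ) : ℝ) * c = c + n * c := by push_cast; ring
    rw [hcost]
    refine pi_cons hq (h 0 a b hab) fun x y hxy => ?_
    simpa only [Fin.foldl_succ, Fin.cons_zero, Fin.cons_succ] using ih (fun i => h i.succ) hxy

theorem measure_le (hq : 0 < q) (h : HolderCoupled R q c P Q) {s : Set X} {t : Set Y}
    (hs : MeasurableSet s) (ht : MeasurableSet t) (hst : ∀ x y, R x y → x ∈ s → y ∈ t) :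
    P s ≤ ENNReal.ofReal (Real.exp c) * Q t ^ q⁻¹ := by
  have hind : ∀ y, t.indicator (1 : Y → ℝ≥0∞) y ^ q = t.indicator 1 y := fun y => by
    by_cases hy : y ∈ t <;> simp [hy, hq]
  have key := h (f := s.indicator 1) (g := t.indicator 1) (measurable_one.indicator hs)
    (measurable_one.indicator ht) fun x y hxy => by
      by_cases hx : x ∈ s
      · simp [hx, hst x y hxy hx]
      · simp [hx]
  simpa only [hind, lintegral_indicator_one hs, lintegral_indicator_one ht] using key

theorem measure_le_exp_mul_add {p : ℝ} (hpq : p.HolderConjugate q) [IsFiniteMeasure Q]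
    (h : HolderCoupled R q c P Q) (ε : ℝ) {s : Set X} {t : Set Y}
    (hs : MeasurableSet s) (ht : MeasurableSet t) (hst : ∀ x y, R x y → x ∈ s → y ∈ t) :
    P s ≤ ENNReal.ofReal (Real.exp ε) * Q t + ENNReal.ofReal (Real.exp (p * c - (p - 1) * ε)) := by
  refine (h.measure_le hpq.symm.pos hs ht hst).trans ?_
  have hQ : Q t = ENNReal.ofReal (Q.real t) := by simp
  rw [hQ, ENNReal.ofReal_rpow_of_nonneg measureReal_nonneg hpq.symm.inv_nonneg,
    ← ENNReal.ofReal_mul (Real.exp_pos _).le, ← ENNReal.ofReal_mul (Real.exp_pos _).le,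
    ← ENNReal.ofReal_add (by positivity) (by positivity)]
  exact ENNReal.ofReal_le_ofReal (exp_mul_rpow_inv_le hpq c ε measureReal_nonneg)

theorem tilted {p : ℝ} (hpq : p.HolderConjugate q) [NeZero P] {φ : X → ℝ} (hφ : Measurable φ)
    (hφ₁ : Integrable (fun x => Real.exp (φ x)) P)
    (hφp : Integrable (fun x => Real.exp (p * φ x)) P) :
    HolderCoupled (· = ·) q (cgf φ P p / p - cgf φ P 1) (P.tilted φ) P := by
  intro f g _ hg hfg
  have hmgf : ∫ x, Real.exp (φ x) ∂P = Real.exp (cgf φ P 1) := by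
    rw [exp_cgf (by simpa using hφ₁)]
    simp [mgf]
  let ρ : X → ℝ≥0∞ := fun x => ENNReal.ofReal (Real.exp (φ x - cgf φ P 1))
  have hρ : Measurable ρ := by fun_prop
  have hρp : ∫⁻ x, ρ x ^ p ∂P = ENNReal.ofReal (Real.exp (cgf φ P p - p * cgf φ P 1)) := by
    have hpow : ∀ x, ρ x ^ p =
        ENNReal.ofReal (Real.exp (p * φ x) * Real.exp (-(p * cgf φ P 1))) := fun x => by
      rw [ENNReal.ofReal_rpow_of_pos (Real.exp_pos _), ← Real.exp_mul, ← Real.exp_add]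
      ring_nf
    simp only [hpow]
    rw [← ofReal_integral_eq_lintegral_ofReal (hφp.mul_const _)
        (.of_forall fun x => by positivity), integral_mul_const, sub_eq_add_neg, Real.exp_add,
      exp_cgf hφp, mgf]
  calc ∫⁻ x, f x ∂(P.tilted φ) ≤ ∫⁻ x, g x ∂(P.tilted φ) := lintegral_mono fun x => hfg x x rfl
    _ = ∫⁻ x, (ρ * g) x ∂P := by
        rw [lintegral_tilted]
        simp only [hmgf, ρ, Pi.mul_apply, Real.exp_sub]
    _ ≤ (∫⁻ x, ρ x ^ p ∂P) ^ (1 / p) * (∫⁻ x, g x ^ q ∂P) ^ (1 / q) :=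
        ENNReal.lintegral_mul_le_Lp_mul_Lq P hpq hρ.aemeasurable hg.aemeasurable
    _ = ENNReal.ofReal (Real.exp (cgf φ P p / p - cgf φ P 1)) * (∫⁻ x, g x ^ q ∂P) ^ q⁻¹ := by
        rw [hρp, ENNReal.ofReal_rpow_of_pos (Real.exp_pos _), ← Real.exp_mul, one_div q]
        congr 4
        field_simp [hpq.ne_zero]

theorem of_map {Q : Measure X'} {φ : X → X'} (h : HolderCoupled (· = ·) q c (P.map φ) Q)
    (hφ : Measurable φ) : HolderCoupled (fun x y => y = φ x) q c P Q := by
  intro f g _ hg hfg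
  calc ∫⁻ x, f x ∂P ≤ ∫⁻ x, g (φ x) ∂P := lintegral_mono fun x => hfg x (φ x) rfl
    _ = ∫⁻ y, g y ∂(P.map φ) := (lintegral_map hg hφ).symm
    _ ≤ _ := h hg hg fun x y hxy => hxy ▸ le_rfl

end HolderCoupled

section Gaussian

variable {m s t : ℝ} {v : ℝ≥0}

theorem gaussianReal_tilted_mul :
    (gaussianReal m v).tilted (t * ·) = gaussianReal (m + v * t) v := by
  have := isProbabilityMeasure_tilted (integrable_exp_mul_gaussianReal (μ := m) (v := v) t)
  have hnorm : ∫ x, Real.exp (t * x) ∂(gaussianReal m v) = Real.exp (m * t + v * t ^ 2 / 2) :=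
    congrFun mgf_id_gaussianReal t
  refine Measure.ext_of_complexMGF_id_eq (funext fun z => ?_)
  calc complexMGF id ((gaussianReal m v).tilted (t * ·)) z
      = Complex.exp (-(m * t + v * t ^ 2 / 2)) * complexMGF id (gaussianReal m v) (t + z) := by
        simp only [complexMGF, id, integral_tilted, hnorm, ← integral_const_mul]
        congr with x
        rw [← Real.exp_sub, Complex.real_smul, Complex.ofReal_exp, ← Complex.exp_add,
          ← Complex.exp_add]
        push_cast
        ring_nf
    _ = complexMGF id (gaussianReal (m + v * t) v) z := by
        rw [complexMGF_id_gaussianReal, complexMGF_id_gaussianReal, ← Complex.exp_add]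
        push_cast
        ring_nf

theorem holderCoupled_gaussianReal_add {p q : ℝ} (hpq : p.HolderConjugate q)
    (hv : v = 0 → s = 0) :
    HolderCoupled (fun x y => y = x + s) q ((p - 1) / 2 * (s ^ 2 / v)) (gaussianReal m v)
      (gaussianReal m v) := by
  refine .of_map ?_ (measurable_add_const s)
  have hs : s = v * (s / v) := by
    by_cases h : v = 0
    · simp [h, hv h]
    · field_simp
  have hcgf : ∀ u, cgf (fun x => s / v * x) (gaussianReal m v) u =
      m * (s / v * u) + v * (s / v * u) ^ 2 / 2 := fun u => by
    rw [cgf, mgf_const_mul, ← cgf, cgf_gaussianReal Measure.map_id']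
  have hint : ∀ u, Integrable (fun x => Real.exp (u * (s / v * x))) (gaussianReal m v) :=
    fun u => by simpa only [mul_assoc] using integrable_exp_mul_gaussianReal (u * (s / v))
  have key := HolderCoupled.tilted hpq (P := gaussianReal m v) (φ := (s / v * ·)) (by fun_prop)
    (by simpa using hint 1) (hint p)
  rw [gaussianReal_tilted_mul, ← hs, ← gaussianReal_map_add_const] at key
  refine key.mono (fun _ _ => id) (le_of_eq ?_)
  rw [hcgf, hcgf]
  by_cases h : v = 0
  · simp [h]
  · field_simp [hpq.ne_zero]
    ring

end Gaussian

namespace PrivateFW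

section Frobenius

attribute [local instance] Matrix.frobeniusNormedAddCommGroup Matrix.frobeniusNormedSpace

variable {a b : ℕ} (A B : Matrix (Fin a) (Fin b) ℂ)

theorem frobNorm_eq_norm : frobNorm A = ‖A‖ := by
  simp [frobNorm, Matrix.frobenius_norm_def, Real.sqrt_eq_rpow]

theorem frobNorm_nonneg : 0 ≤ frobNorm A :=
  Real.sqrt_nonneg _

theorem frobNorm_sq : frobNorm A ^ 2 = ∑ i, ∑ j, ‖A i j‖ ^ 2 :=
  Real.sq_sqrt (by positivity)

theorem frobNorm_eq_zero : frobNorm A = 0 ↔ A = 0 := by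
  rw [frobNorm_eq_norm, norm_eq_zero]

theorem frobNorm_smul (c : ℂ) : frobNorm (c • A) = ‖c‖ * frobNorm A := by
  simp only [frobNorm_eq_norm, norm_smul]

theorem frobNorm_sub_le : frobNorm (A - B) ≤ frobNorm A + frobNorm B := by
  simpa only [frobNorm_eq_norm] using norm_sub_le A B

theorem frobNorm_conjTranspose_mul_self_le : frobNorm (Aᴴ * A) ≤ frobNorm A ^ 2 := by
  simp only [frobNorm_eq_norm, sq]
  simpa only [Matrix.frobenius_norm_conjTranspose] using Matrix.frobenius_norm_mul Aᴴ A

theorem continuous_frobNorm : Continuous (frobNorm : Matrix (Fin a) (Fin b) ℂ → ℝ) := by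
  unfold frobNorm
  fun_prop

end Frobenius

section HermitianNoise

variable {τ : ℕ}

/-- The real coordinates of a Hermitian matrix in the parametrization `hermitianOf`. -/
def hermitianCoord (D : Matrix (Fin τ) (Fin τ) ℂ) : Fin τ → Fin τ → ℝ := fun i j =>
  if i ≤ j then (D i j).re else (D j i).im

theorem hermitianOf_add (g h : Fin τ → Fin τ → ℝ) :
    hermitianOf (g + h) = hermitianOf g + hermitianOf h := by
  ext i j
  simp only [hermitianOf, Matrix.of_apply, Matrix.add_apply, Pi.add_apply]
  split_ifs <;> push_cast <;> ring

theorem hermitianOf_hermitianCoord {D : Matrix (Fin τ) (Fin τ) ℂ} (hD : D.IsHermitian) :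
    hermitianOf (hermitianCoord D) = D := by
  ext i j
  have hre : (D j i).re = (D i j).re := by simpa using congrArg Complex.re (hD.apply i j)
  have him : -(D j i).im = (D i j).im := by simpa using congrArg Complex.im (hD.apply i j)
  rcases lt_trichotomy i j with h | rfl | h
  · apply Complex.ext <;> simp [hermitianOf, hermitianCoord, h, h.ne, h.le, h.not_ge]
  · apply Complex.ext
    · simp [hermitianOf, hermitianCoord]
    · simpa [hermitianOf, hermitianCoord] using by linarith
  · apply Complex.ext <;>
      simp [hermitianOf, hermitianCoord, h.ne', h.not_gt, h.le, h.not_ge, hre, him]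

theorem frobNorm_hermitianOf_sq (g : Fin τ → Fin τ → ℝ) :
    frobNorm (hermitianOf g) ^ 2 = ∑ i, ∑ j, (if i = j then 1 else 2) * g i j ^ 2 := by
  have hentry : ∀ i j, ‖hermitianOf g i j‖ ^ 2 = g i j ^ 2 + if j = i then 0 else g j i ^ 2 := by
    intro i j
    rw [← Complex.normSq_eq_norm_sq, Complex.normSq_apply]
    rcases lt_trichotomy i j with h | rfl | h
    · simp [hermitianOf, h, h.ne, h.ne', sq]
    · simp [hermitianOf, sq]
    · simp [hermitianOf, h.ne, h.ne', h.not_gt, sq, add_comm]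
  simp only [frobNorm_sq, hentry, Finset.sum_add_distrib]
  rw [Finset.sum_comm (f := fun i j => if j = i then 0 else g j i ^ 2), ← Finset.sum_add_distrib]
  refine Finset.sum_congr rfl fun i _ => ?_
  rw [← Finset.sum_add_distrib]
  refine Finset.sum_congr rfl fun j _ => ?_
  split_ifs <;> ring

theorem continuous_hermitianOf :
    Continuous (hermitianOf : (Fin τ → Fin τ → ℝ) → Matrix (Fin τ) (Fin τ) ℂ) := by
  refine continuous_matrix fun i j => ?_
  simp only [hermitianOf, Matrix.of_apply]
  split_ifs <;> fun_prop

end HermitianNoise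

section Measurability

variable {a b : ℕ}

instance instBorelSpaceMatrix : BorelSpace (Matrix (Fin a) (Fin b) ℂ) :=
  inferInstanceAs (BorelSpace (Fin a → Fin b → ℂ))

instance instSecondCountableTopologyMatrix :
    SecondCountableTopology (Matrix (Fin a) (Fin b) ℂ) :=
  inferInstanceAs (SecondCountableTopology (Fin a → Fin b → ℂ))

instance instIsProbabilityMeasureHermitianNoise (τ : ℕ) (μ : ℝ) :
    IsProbabilityMeasure (hermitianNoise τ μ) :=
  Measure.isProbabilityMeasure_map continuous_hermitianOf.measurable.aemeasurable

instance instIsProbabilityMeasureNoiseLaw (T M τ : ℕ) (μ : ℝ) :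
    IsProbabilityMeasure (noiseLaw T M τ μ) :=
  inferInstanceAs (IsProbabilityMeasure (Measure.pi _))

theorem continuous_restrictTo (Ω : Finset (Fin a × Fin b)) : Continuous (restrictTo Ω) := by
  refine continuous_matrix fun i j => ?_
  simp only [restrictTo, Matrix.of_apply]
  split_ifs <;> fun_prop

theorem measurable_clip (L : ℝ) (Ω : Finset (Fin a × Fin b)) : Measurable (clip L Ω) := by
  have hnorm : Measurable fun A => frobNorm (restrictTo Ω A) :=
    (continuous_frobNorm.comp (continuous_restrictTo Ω)).measurable
  refine Measurable.ite (measurableSet_le hnorm measurable_const) measurable_id ?_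
  exact (Complex.measurable_ofReal.comp (hnorm.const_div L)).smul measurable_id

variable {M Na τ T K : ℕ} {L μ : ℝ} {cpu : Matrix (Fin τ) (Fin τ) ℂ → ℝ × (Fin τ → ℂ)}

theorem continuous_residual (d : LocalData Na τ) : Continuous (residual d) :=
  (continuous_restrictTo d.mask).sub continuous_const

theorem continuous_noisyGram (d : LocalData Na τ) {Z : Type*} [TopologicalSpace Z]
    {X : Z → Matrix (Fin Na) (Fin τ) ℂ} {G : Z → Matrix (Fin τ) (Fin τ) ℂ} (hX : Continuous X)
    (hG : Continuous G) : Continuous fun z => noisyGram d (X z) (G z) := by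
  have hres : Continuous fun z => residual d (X z) := (continuous_residual d).comp hX
  exact (hres.matrix_conjTranspose.matrix_mul hres).add hG

theorem measurable_localUpdate (η : ℝ) (d : LocalData Na τ) {Z : Type*} [MeasurableSpace Z]
    {X : Z → Matrix (Fin Na) (Fin τ) ℂ} {l : Z → ℝ} {v : Z → Fin τ → ℂ} (hX : Measurable X)
    (hl : Measurable l) (hv : Measurable v) :
    Measurable fun z => localUpdate K L η d (X z) (l z) (v z) := by
  have hdir : Continuous fun z : Matrix (Fin Na) (Fin τ) ℂ × (Fin τ → ℂ) =>
      residual d z.1 * Matrix.vecMulVec z.2 (star z.2) :=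
    ((continuous_residual d).comp continuous_fst).matrix_mul
      (continuous_snd.matrix_vecMulVec continuous_snd.star)
  have hdir' : Measurable fun z => residual d (X z) * Matrix.vecMulVec (v z) (star (v z)) :=
    (hdir.measurable.comp (hX.prodMk hv) :)
  have hcoef : Measurable fun z => ((η * K / l z : ℝ) : ℂ) := by fun_prop
  have hkeep : Measurable fun z => ((1 - η : ℝ) : ℂ) • X z := hX.const_smul ((1 - η : ℝ) : ℂ)
  have hmove : Measurable fun z => ((η * K / l z : ℝ) : ℂ) •
      (residual d (X z) * Matrix.vecMulVec (v z) (star (v z))) := hcoef.smul hdir'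
  exact (measurable_clip L d.mask).comp (hkeep.sub hmove)

theorem measurable_fwStep (η : ℝ) (hcpu : Measurable cpu) (Y : Fin M → LocalData Na τ)
    {Z : Type*} [MeasurableSpace Z] {G : Z → Fin M → Matrix (Fin τ) (Fin τ) ℂ}
    {X : Z → Fin M → Matrix (Fin Na) (Fin τ) ℂ} (hG : Measurable G) (hX : Measurable X) :
    Measurable fun z => fwStep K L μ η cpu Y (G z) (X z) := by
  have hsum : Continuous fun z : (Fin M → Matrix (Fin τ) (Fin τ) ℂ) ×
      (Fin M → Matrix (Fin Na) (Fin τ) ℂ) => ∑ m, noisyGram (Y m) (z.2 m) (z.1 m) :=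
    continuous_finsetSum _ fun m _ => continuous_noisyGram (Y m)
      ((continuous_apply m).comp continuous_snd) ((continuous_apply m).comp continuous_fst)
  have hrule : Measurable fun z => cpu (∑ m, noisyGram (Y m) (X z m) (G z m)) :=
    hcpu.comp (hsum.measurable.comp (hG.prodMk hX) :)
  exact measurable_pi_lambda _ fun m => measurable_localUpdate η (Y m)
    ((measurable_pi_apply m).comp hX) (hrule.fst.add_const _) hrule.snd

theorem measurable_fwIterate (hcpu : Measurable cpu) (Y : Fin M → LocalData Na τ) (n : ℕ)
    (hn : n ≤ T) : Measurable fun G => fwIterate K L μ cpu Y G n hn := by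
  induction n with
  | zero => exact measurable_const
  | succ n ih => exact measurable_fwStep _ hcpu Y (measurable_pi_apply _) (ih _)

end Measurability

section Sensitivity

variable {a b Na τ : ℕ} {L : ℝ}

theorem restrictTo_smul (Ω : Finset (Fin a × Fin b)) (c : ℂ) (A : Matrix (Fin a) (Fin b) ℂ) :
    restrictTo Ω (c • A) = c • restrictTo Ω A := by
  ext i j
  simp [restrictTo]

theorem frobNorm_restrictTo_clip_le (hL : 0 ≤ L) (Ω : Finset (Fin a × Fin b))
    (A : Matrix (Fin a) (Fin b) ℂ) : frobNorm (restrictTo Ω (clip L Ω A)) ≤ L := by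
  unfold clip
  split_ifs with h
  · exact h
  · have hpos : 0 < frobNorm (restrictTo Ω A) := hL.trans_lt (not_le.1 h)
    rw [restrictTo_smul, frobNorm_smul, Complex.norm_real, Real.norm_of_nonneg (by positivity),
      div_mul_cancel₀ _ hpos.ne']

theorem frobNorm_residual_le {d : LocalData Na τ} {X : Matrix (Fin Na) (Fin τ) ℂ}
    (hd : frobNorm d.signal ≤ L) (hX : frobNorm (restrictTo d.mask X) ≤ L) :
    frobNorm (residual d X) ≤ 2 * L :=
  (frobNorm_sub_le _ _).trans (by linarith)

/-- The change of the Gram matrix `Jᴴ J` of one access point between two runs; this is what the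
noise has to hide. -/
def gramDiff (d d' : LocalData Na τ) (X X' : Matrix (Fin Na) (Fin τ) ℂ) :
    Matrix (Fin τ) (Fin τ) ℂ :=
  (residual d X)ᴴ * residual d X - (residual d' X')ᴴ * residual d' X'

theorem isHermitian_gramDiff (d d' : LocalData Na τ) (X X' : Matrix (Fin Na) (Fin τ) ℂ) :
    (gramDiff d d' X X').IsHermitian :=
  (Matrix.isHermitian_conjTranspose_mul_self _).sub (Matrix.isHermitian_conjTranspose_mul_self _)

theorem frobNorm_gramDiff_le {d d' : LocalData Na τ} {X X' : Matrix (Fin Na) (Fin τ) ℂ}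
    (hd : frobNorm d.signal ≤ L) (hd' : frobNorm d'.signal ≤ L)
    (hX : frobNorm (restrictTo d.mask X) ≤ L) (hX' : frobNorm (restrictTo d'.mask X') ≤ L) :
    frobNorm (gramDiff d d' X X') ≤ 8 * L ^ 2 := by
  have hgram : ∀ J : Matrix (Fin Na) (Fin τ) ℂ, frobNorm J ≤ 2 * L →
      frobNorm (Jᴴ * J) ≤ (2 * L) ^ 2 := fun J hJ =>
    (frobNorm_conjTranspose_mul_self_le J).trans (pow_le_pow_left₀ (frobNorm_nonneg J) hJ 2)
  calc frobNorm (gramDiff d d' X X')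
      ≤ frobNorm ((residual d X)ᴴ * residual d X)
          + frobNorm ((residual d' X')ᴴ * residual d' X') := frobNorm_sub_le _ _
    _ ≤ (2 * L) ^ 2 + (2 * L) ^ 2 := add_le_add (hgram _ (frobNorm_residual_le hd hX))
        (hgram _ (frobNorm_residual_le hd' hX'))
    _ = 8 * L ^ 2 := by ring

end Sensitivity

section Coupling

variable {M Na τ T K : ℕ} {L μ p q : ℝ} {cpu : Matrix (Fin τ) (Fin τ) ℂ → ℝ × (Fin τ → ℂ)}

theorem holderCoupled_hermitianNoise_add (hpq : p.HolderConjugate q)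
    {D : Matrix (Fin τ) (Fin τ) ℂ} (hD : D.IsHermitian) (hμ : μ = 0 → D = 0) :
    HolderCoupled (fun G G' => G' = G + D) q ((p - 1) / 2 * (frobNorm D ^ 2 / μ ^ 2))
      (hermitianNoise τ μ) (hermitianNoise τ μ) := by
  let g := hermitianCoord D
  let v : Fin τ → Fin τ → ℝ≥0 := fun i j =>
    if i = j then (μ ^ 2).toNNReal else (μ ^ 2 / 2).toNNReal
  have hv : ∀ i j, v i j = 0 → g i j = 0 := fun i j hij => by
    have hμ0 : μ = 0 := by
      by_contra hne
      have : 0 < v i j := by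
        simp only [v]
        split_ifs <;> exact Real.toNNReal_pos.2 (by positivity)
      exact this.ne' hij
    simp [g, hermitianCoord, hμ hμ0]
  have hcost : ∑ i, ∑ j, (p - 1) / 2 * (g i j ^ 2 / v i j) =
      (p - 1) / 2 * (frobNorm D ^ 2 / μ ^ 2) := by
    have hterm : ∀ i j, g i j ^ 2 / v i j = (if i = j then 1 else 2) * g i j ^ 2 / μ ^ 2 :=
      fun i j => by
        simp only [v]
        split_ifs
        · rw [Real.coe_toNNReal _ (by positivity), one_mul]
        · rw [Real.coe_toNNReal _ (by positivity), div_div_eq_mul_div, mul_comm]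
    rw [← hermitianOf_hermitianCoord hD, frobNorm_hermitianOf_sq]
    simp only [hterm, Finset.mul_sum, Finset.sum_div, g]
  have hq := hpq.symm.ne_zero
  rw [← hcost]
  refine .map (((HolderCoupled.pi hq fun i => .pi hq fun j =>
      holderCoupled_gaussianReal_add (m := 0) hpq (hv i j))).mono (fun x y hxy => ?_) le_rfl)
    continuous_hermitianOf.measurable continuous_hermitianOf.measurable
  have hyx : y = x + g := funext fun i => funext fun j => hxy i j
  rw [hyx, hermitianOf_add, hermitianOf_hermitianCoord hD]

/-- The relation between the iterates `X`, `X'` of two runs whose data `Y`, `Y'` differ at the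
access point `m` only which the coupling of the two runs preserves. -/
structure IteratesCoupled (L : ℝ) (m : Fin M) (Y Y' : Fin M → LocalData Na τ)
    (X X' : Fin M → Matrix (Fin Na) (Fin τ) ℂ) : Prop where
  eq_of_ne : ∀ j, j ≠ m → X j = X' j
  frobNorm_le_left : frobNorm (restrictTo (Y m).mask (X m)) ≤ L
  frobNorm_le_right : frobNorm (restrictTo (Y' m).mask (X' m)) ≤ L

variable {m : Fin M} {Y Y' : Fin M → LocalData Na τ} {X X' : Fin M → Matrix (Fin Na) (Fin τ) ℂ}

theorem sum_noisyGram_eq_of_shift (hY : ∀ j, j ≠ m → Y j = Y' j) (hX : ∀ j, j ≠ m → X j = X' j)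
    {G G' : Fin M → Matrix (Fin τ) (Fin τ) ℂ}
    (hG : ∀ j, G' j = G j + (M : ℂ)⁻¹ • gramDiff (Y m) (Y' m) (X m) (X' m)) :
    ∑ j, noisyGram (Y' j) (X' j) (G' j) = ∑ j, noisyGram (Y j) (X j) (G j) := by
  have hM : (M : ℂ) ≠ 0 := Nat.cast_ne_zero.2 m.pos.ne'
  have hshift : ∑ _j : Fin M, (M : ℂ)⁻¹ • gramDiff (Y m) (Y' m) (X m) (X' m) =
      gramDiff (Y m) (Y' m) (X m) (X' m) := by
    rw [Finset.sum_const, Finset.card_fin, ← Nat.cast_smul_eq_nsmul ℂ, smul_inv_smul₀ hM]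
  have hgram : ∑ j, gramDiff (Y j) (Y' j) (X j) (X' j) = gramDiff (Y m) (Y' m) (X m) (X' m) :=
    Finset.sum_eq_single m
      (fun j _ hj => by rw [hY j hj, hX j hj, gramDiff, sub_self]) (by simp)
  rw [← sub_eq_zero, ← Finset.sum_sub_distrib]
  calc ∑ j, (noisyGram (Y' j) (X' j) (G' j) - noisyGram (Y j) (X j) (G j))
      = ∑ j, ((M : ℂ)⁻¹ • gramDiff (Y m) (Y' m) (X m) (X' m)
          - gramDiff (Y j) (Y' j) (X j) (X' j)) := by
        refine Finset.sum_congr rfl fun j _ => ?_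
        rw [hG j, noisyGram, noisyGram, gramDiff.eq_def (Y j)]
        abel
    _ = 0 := by rw [Finset.sum_sub_distrib, hshift, hgram, sub_self]

theorem IteratesCoupled.fwStep (hL : 0 ≤ L) (η : ℝ) (hY : ∀ j, j ≠ m → Y j = Y' j)
    (hX : IteratesCoupled L m Y Y' X X') {G G' : Fin M → Matrix (Fin τ) (Fin τ) ℂ}
    (hG : ∀ j, G' j = G j + (M : ℂ)⁻¹ • gramDiff (Y m) (Y' m) (X m) (X' m)) :
    IteratesCoupled L m Y Y' (fwStep K L μ η cpu Y G X) (fwStep K L μ η cpu Y' G' X') where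
  eq_of_ne j hj := by
    simp only [PrivateFW.fwStep, sum_noisyGram_eq_of_shift hY hX.eq_of_ne hG, hY j hj,
      hX.eq_of_ne j hj]
  frobNorm_le_left := frobNorm_restrictTo_clip_le hL _ _
  frobNorm_le_right := frobNorm_restrictTo_clip_le hL _ _

/-- The cost of coupling one iteration with noise level `μ`, at the order `p`: each of the `M`
access points shifts its noise matrix by at most `8 L² / M` in Frobenius norm. -/
noncomputable def stepCost (M : ℕ) (L μ p : ℝ) : ℝ :=
  (p - 1) / 2 * ((8 * L ^ 2) ^ 2 / (M * μ ^ 2))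

theorem holderCoupled_fwStep (hpq : p.HolderConjugate q) (hμ : μ = 0 → L = 0) (η : ℝ)
    (hYm : frobNorm (Y m).signal ≤ L) (hYm' : frobNorm (Y' m).signal ≤ L)
    (hY : ∀ j, j ≠ m → Y j = Y' j) (hX : IteratesCoupled L m Y Y' X X') :
    HolderCoupled (fun G G' => IteratesCoupled L m Y Y' (fwStep K L μ η cpu Y G X)
        (fwStep K L μ η cpu Y' G' X')) q (stepCost M L μ p)
      (Measure.pi fun _ : Fin M => hermitianNoise τ μ)
      (Measure.pi fun _ : Fin M => hermitianNoise τ μ) := by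
  have hL : 0 ≤ L := (frobNorm_nonneg _).trans hYm
  have hM : (0 : ℝ) < M := Nat.cast_pos.2 m.pos
  set D := gramDiff (Y m) (Y' m) (X m) (X' m)
  have hDL : frobNorm D ≤ 8 * L ^ 2 :=
    frobNorm_gramDiff_le hYm hYm' hX.frobNorm_le_left hX.frobNorm_le_right
  have hherm : ((M : ℂ)⁻¹ • D).IsHermitian :=
    (isHermitian_gramDiff _ _ _ _).smul (by simp [IsSelfAdjoint])
  have hzero : μ = 0 → (M : ℂ)⁻¹ • D = 0 := fun h => by
    have hD0 : frobNorm D = 0 :=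
      le_antisymm (by simpa [hμ h] using hDL) (frobNorm_nonneg D)
    rw [(frobNorm_eq_zero D).1 hD0, smul_zero]
  refine (HolderCoupled.pi hpq.symm.ne_zero fun _ : Fin M =>
    holderCoupled_hermitianNoise_add hpq hherm hzero).mono
    (fun G G' hG => hX.fwStep hL η hY hG) ?_
  calc ∑ _j : Fin M, (p - 1) / 2 * (frobNorm ((M : ℂ)⁻¹ • D) ^ 2 / μ ^ 2)
      = (p - 1) / 2 * (frobNorm D ^ 2 / (M * μ ^ 2)) := by
        rw [Finset.sum_const, Finset.card_fin, nsmul_eq_mul, frobNorm_smul, norm_inv,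
          Complex.norm_natCast]
        field_simp
    _ ≤ stepCost M L μ p := by
        unfold stepCost
        have := hpq.sub_one_pos
        have := frobNorm_nonneg D
        gcongr

theorem fwIterate_eq_foldl (Y : Fin M → LocalData Na τ)
    (G : Fin T → Fin M → Matrix (Fin τ) (Fin τ) ℂ) (n : ℕ) (hn : n ≤ T) :
    fwIterate K L μ cpu Y G n hn = Fin.foldl n
      (fun X i => fwStep K L μ (stepSize T (i + 1)) cpu Y (G (i.castLE hn)) X) 0 := by
  induction n with
  | zero => rw [fwIterate, Fin.foldl_zero]
  | succ n ih =>
    rw [fwIterate, Fin.foldl_succ_last, ih]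
    rfl

theorem holderCoupled_privateFW (hpq : p.HolderConjugate q) (hμ : μ = 0 → L = 0)
    (hYm : frobNorm (Y m).signal ≤ L) (hYm' : frobNorm (Y' m).signal ≤ L)
    (hY : ∀ j, j ≠ m → Y j = Y' j) :
    HolderCoupled (fun G G' => IteratesCoupled L m Y Y' (privateFW K L μ cpu Y G)
        (privateFW K L μ cpu Y' G'))
      q (T * stepCost M L μ p) (noiseLaw T M τ μ) (noiseLaw T M τ μ) := by
  have hL : 0 ≤ L := (frobNorm_nonneg _).trans hYm
  have hzero : ∀ Ω : Finset (Fin Na × Fin τ), frobNorm (restrictTo Ω 0) ≤ L := fun Ω => by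
    simpa [frobNorm, restrictTo] using hL
  have h0 : IteratesCoupled L m Y Y' 0 0 := ⟨fun _ _ => rfl, hzero _, hzero _⟩
  simp only [privateFW, fwIterate_eq_foldl, Fin.castLE_rfl, id]
  exact HolderCoupled.foldl hpq.symm.ne_zero
    (fun i _ _ hX => holderCoupled_fwStep hpq hμ (stepSize T (i + 1)) hYm hYm' hY hX) h0

end Coupling

section JointDP

variable {M : ℕ} {D Ω Z : Type*} [MeasurableSpace Ω] [MeasurableSpace Z] {P : Measure Ω}
  {A : (Fin M → D) → Ω → Fin M → Z} {possible : D → Prop} {ε δ : ℝ}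

theorem isJointDP_of_one_le [IsProbabilityMeasure P] (hδ : 1 ≤ δ) : IsJointDP P A possible ε δ :=
  fun _ _ _ _ _ _ _ _ => prob_le_one.trans (le_add_left (by rwa [ENNReal.one_le_ofReal]))

theorem isJointDP_of_holderCoupled [IsFiniteMeasure P] {p q c : ℝ} (hpq : p.HolderConjugate q)
    (hA : ∀ Y, Measurable (A Y)) (hδ : 0 < δ) (hc : p * c - (p - 1) * ε ≤ Real.log δ)
    (h : ∀ m Y Y', (∀ j, possible (Y j)) → (∀ j, possible (Y' j)) → (∀ j, j ≠ m → Y j = Y' j) →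
      HolderCoupled (fun ω ω' => ∀ j, j ≠ m → A Y ω j = A Y' ω' j) q c P P) :
    IsJointDP P A possible ε δ := by
  intro m Y Y' hY hY' hYY' S hS
  have hmeas : ∀ Y, Measurable fun ω (j : {j : Fin M // j ≠ m}) => A Y ω j := fun Y =>
    measurable_pi_lambda _ fun j => measurable_pi_iff.1 (hA Y) j
  have hsub : ∀ ω ω', (∀ j, j ≠ m → A Y ω j = A Y' ω' j) →
      (fun j : {j : Fin M // j ≠ m} => A Y ω j) ∈ S →
      (fun j : {j : Fin M // j ≠ m} => A Y' ω' j) ∈ S := fun ω ω' hω hωS => by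
    convert! hωS using 2 with j
    exact (hω j j.2).symm
  calc P {ω | (fun j : {j : Fin M // j ≠ m} => A Y ω j) ∈ S} ≤
        ENNReal.ofReal (Real.exp ε) * P {ω | (fun j : {j : Fin M // j ≠ m} => A Y' ω j) ∈ S}
          + ENNReal.ofReal (Real.exp (p * c - (p - 1) * ε)) :=
        (h m Y Y' hY hY' hYY').measure_le_exp_mul_add hpq ε (hmeas Y hS) (hmeas Y' hS) hsub
    _ ≤ _ := by
        gcongr
        exact (Real.le_log_iff_exp_le hδ).1 hc

end JointDP

section Calibration

variable {M T : ℕ} {L ε δ : ℝ}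

theorem noiseLevel_sq (ha : 0 ≤ Real.log (2.5 * T / δ)) (hb : 0 ≤ Real.log (2 / δ)) :
    noiseLevel M T L ε δ ^ 2 =
      256 * L ^ 4 * (T / M * Real.log (2.5 * T / δ) * Real.log (2 / δ)) / ε ^ 2 := by
  rw [noiseLevel, div_pow, mul_pow, Real.sq_sqrt (by positivity)]
  ring

theorem noiseLevel_eq_zero_iff (hM : 0 < M) (hT : 0 < T) (hε : 0 < ε)
    (ha : 0 < Real.log (2.5 * T / δ)) (hb : 0 < Real.log (2 / δ)) :
    noiseLevel M T L ε δ = 0 ↔ L = 0 := by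
  have hsqrt : 0 < √((T : ℝ) / M * Real.log (2.5 * T / δ) * Real.log (2 / δ)) := by positivity
  simp [noiseLevel, hε.ne', hsqrt.ne']

theorem log_two_div_pos (hδ : 0 < δ) (hδ1 : δ < 1) : 0 < Real.log (2 / δ) :=
  Real.log_pos (by rw [lt_div_iff₀ hδ]; linarith)

theorem log_two_div_add_le (hT : 0 < T) (hδ : 0 < δ) :
    Real.log (2 / δ) + 1 / 5 ≤ Real.log (2.5 * T / δ) := by
  have hT1 : (1 : ℝ) ≤ T := Nat.one_le_cast.2 hT
  have hquarter : 1 / 5 ≤ Real.log (5 / 4) := by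
    have := Real.one_sub_inv_le_log_of_pos (x := 5 / 4) (by norm_num)
    norm_num at this ⊢
    exact this
  calc Real.log (2 / δ) + 1 / 5 ≤ Real.log (2 / δ) + Real.log (5 / 4) := by gcongr
    _ = Real.log (2.5 / δ) := by
        rw [← Real.log_mul (by positivity) (by norm_num)]
        ring_nf
    _ ≤ Real.log (2.5 * T / δ) := by
        gcongr
        linarith

theorem half_sub_le_log (hT : 0 < T) (hε : ε ≤ 2) (hδ : 0 < δ) (hδ1 : δ < 1) :
    ε / 2 - 2 * Real.log (2.5 * T / δ) * Real.log (2 / δ) ≤ Real.log δ := by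
  have ha := log_two_div_add_le hT hδ
  have hb : Real.log (2 / δ) = Real.log 2 - Real.log δ := Real.log_div two_ne_zero hδ.ne'
  have hlogδ : Real.log δ < 0 := Real.log_neg hδ hδ1
  have hlog2 := Real.log_two_gt_d9
  nlinarith [mul_le_mul_of_nonneg_right ha (log_two_div_pos hδ hδ1).le]

theorem log_mul_div_pos (hT : 0 < T) (hδ : 0 < δ) (hδ1 : δ < 1) :
    0 < Real.log (2.5 * T / δ) := by
  linarith [log_two_div_add_le hT hδ, log_two_div_pos hδ hδ1]

/-- The order `p` of the Rényi divergence at which privacy is accounted, chosen such that the total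
cost of all `T` iterations at the calibrated noise level is `ε / 2`. -/
noncomputable def renyiOrder (T : ℕ) (ε δ : ℝ) : ℝ :=
  1 + 4 * Real.log (2.5 * T / δ) * Real.log (2 / δ) / ε

theorem one_lt_renyiOrder (hT : 0 < T) (hε : 0 < ε) (hδ : 0 < δ) (hδ1 : δ < 1) :
    1 < renyiOrder T ε δ := by
  have := log_mul_div_pos hT hδ hδ1
  have := log_two_div_pos hδ hδ1
  exact lt_add_of_pos_right 1 (by positivity)

theorem renyiOrder_mul_sub_le_log (hT : 0 < T) (hε : 0 < ε) (hε2 : ε ≤ 2) (hδ : 0 < δ)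
    (hδ1 : δ < 1) : renyiOrder T ε δ * (ε / 2) - (renyiOrder T ε δ - 1) * ε ≤ Real.log δ := by
  refine le_of_eq_of_le ?_ (half_sub_le_log hT hε2 hδ hδ1)
  rw [renyiOrder]
  field_simp
  ring

theorem mul_stepCost_noiseLevel_le (hM : 0 < M) (hT : 0 < T) (hε : 0 < ε) (hδ : 0 < δ)
    (hδ1 : δ < 1) :
    T * stepCost M L (noiseLevel M T L ε δ) (renyiOrder T ε δ) ≤ ε / 2 := by
  have ha := log_mul_div_pos hT hδ hδ1
  have hb := log_two_div_pos hδ hδ1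
  rw [stepCost, renyiOrder, noiseLevel_sq ha.le hb.le]
  rcases eq_or_ne L 0 with rfl | hL
  · simpa using (half_pos hε).le
  · generalize Real.log (2.5 * T / δ) = a at *
    generalize Real.log (2 / δ) = b at *
    refine le_of_eq ?_
    field_simp
    ring

end Calibration

end PrivateFW

open PrivateFW in
theorem theorem1_general (M Na τ K T : ℕ) (hT : 0 < T) (L ε δ : ℝ) (hε : 0 < ε) (hε2 : ε ≤ 2)
    (hδ : 0 < δ) (cpu : Matrix (Fin τ) (Fin τ) ℂ → ℝ × (Fin τ → ℂ)) (hcpu_meas : Measurable cpu) :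
    IsJointDP (noiseLaw T M τ (noiseLevel M T L ε δ))
      (privateFW (M := M) (Na := Na) (τ := τ) (T := T) K L (noiseLevel M T L ε δ) cpu)
      (LocalData.IsPossible L) ε δ := by
  rcases le_or_gt 1 δ with hδ1 | hδ1
  · exact isJointDP_of_one_le hδ1
  have hpq := Real.HolderConjugate.conjExponent (one_lt_renyiOrder hT hε hδ hδ1)
  refine isJointDP_of_holderCoupled hpq (fun Y => measurable_fwIterate hcpu_meas Y T le_rfl) hδ
    (renyiOrder_mul_sub_le_log hT hε hε2 hδ hδ1) fun m Y Y' hY hY' hYY' => ?_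
  have hL : noiseLevel M T L ε δ = 0 → L = 0 :=
    (noiseLevel_eq_zero_iff m.pos hT hε (log_mul_div_pos hT hδ hδ1) (log_two_div_pos hδ hδ1)).1
  exact (holderCoupled_privateFW hpq hL (hY m).2 (hY' m).2 hYY').mono
    (fun _ _ h => h.eq_of_ne) (mul_stepCost_noiseLevel_le m.pos hT hε hδ hδ1)

theorem theorem1 (M Na τ K T : ℕ) (hT : 0 < T) (L ε δ : ℝ) (hε : 0 < ε) (hε1 : ε ≤ 1) (hδ : 0 < δ)
    (cpu : Matrix (Fin τ) (Fin τ) ℂ → ℝ × (Fin τ → ℂ)) (hcpu_meas : Measurable cpu)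
    (hcpu : PrivateFW.IsTopEigenRule cpu) :
    PrivateFW.IsJointDP
      (PrivateFW.noiseLaw T M τ (PrivateFW.noiseLevel M T L ε δ))
      (PrivateFW.privateFW (M := M) (Na := Na) (τ := τ) (T := T) K L
        (PrivateFW.noiseLevel M T L ε δ) cpu)
      (PrivateFW.LocalData.IsPossible L) ε δ :=
  theorem1_general M Na τ K T hT L ε δ hε (hε1.trans one_le_two) hδ cpu hcpu_meas
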